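/- Let $G$ be a finite simple graph on a set $\Pi$ of $l$ vertices, and let $\chi_G(q)$ be its chromatic polynomial. Let $\mathcal{L}_G$ be the bond lattice of $G$: the set of all partitions of $\Pi$ into non-empty parts each of which induces a connected subgraph of $G$, ordered by refinement ($\pi > \pi'$ iff $\pi'$ refines $\pi$ and $\pi'\neq\pi$); its minimal element is the partition $\hat{0}$ into singletons. Write $\pi \to \pi'$ if $\pi$ covers $\pi'$ in $\mathcal{L}_G$; then $\pi'$ arises from $\pi$ by splitting one part $S$ of $\pi$ into two parts $S', S''$, and we put $$w(\pi,\pi') := \frac{1}{d(\pi)}\,\frac{e(S',S'')}{e(S)},$$ where $d(\pi)$ is the number of non-singleton parts of $\pi$, $e(S)$ is the number of edges of $G$ with both ends in $S$, and $e(S',S'')$ is the number of edges of $G$ with one end in $S'$ and the other in $S''$. Let $W$ be the square matrix with rows and columns indexed by $\mathcal{L}_G$ and entries $$W_{\pi,\pi'} := \begin{cases} -w(\pi,\pi') & \text{if } \pi\to\pi',\\ q & \text{if } \pi=\pi'=\hat{0},\\ 0 & \text{otherwise,}\end{cases}$$ and let $\zeta$ be the column vector indexed by $\mathcal{L}_G$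 all of whose entries are $1$. Then, as polynomials in $q$, $$\chi_G(q) = \zeta^{T}\, W^{l}\, \zeta .$$ -/

import Mathlib

open Finset Polynomial

/-! ### The chromatic polynomial -/

section Chromatic

variable {V : Type*} [Fintype V]

/-- The number `c_k(G)` of ordered partitions of the vertex set into `k` (non-empty) independent
sets `(J_1, …, J_k)`, i.e. of surjective proper colourings with colour set `Fin k`. -/
noncomputable def orderedIndepPartitions (G : SimpleGraph V) (k : ℕ) : ℕ :=
  Nat.card {C : G.Coloring (Fin k) // Function.Surjective C}

/-- The chromatic polynomial `∑_k c_k(G) * binom(q, k)`, with `q = X`. The theorem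
`chromaticPolynomial_eval` shows that its value at each `n : ℕ` is the number of proper
`n`-colourings. (The term `k = 0` is nonzero only if `V` is empty.) -/
noncomputable def chromaticPolynomial (G : SimpleGraph V) : ℚ[X] :=
  ∑ k ∈ range (Fintype.card V + 1),
    C ((orderedIndepPartitions G k : ℚ) / (k.factorial : ℚ)) * descPochhammer ℚ k

theorem orderedIndepPartitions_eq_zero (G : SimpleGraph V) {k : ℕ} (hk : Fintype.card V < k) :
    orderedIndepPartitions G k = 0 := by
  have : IsEmpty {C : G.Coloring (Fin k) // Function.Surjective C} := by
    refine ⟨fun ⟨C, hC⟩ => ?_⟩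
    have := Fintype.card_le_of_surjective C hC
    simp at this
    omega
  simp [orderedIndepPartitions]

theorem card_coloring_image (G : SimpleGraph V) {n : ℕ} (s : Finset (Fin n)) :
    Nat.card {C : G.Coloring (Fin n) // univ.image C = s} = orderedIndepPartitions G #s := by
  classical
  let e : s ≃ Fin #s := s.equivFin
  have key : ∀ (C : G.Coloring (Fin n)), univ.image C = s → ∀ v, C v ∈ s := by
    intro C hC v
    rw [← hC]
    exact mem_image_of_mem _ (mem_univ v)
  refine Nat.card_congr
    { toFun := fun C => ⟨SimpleGraph.Coloring.mk (fun v => e ⟨C.1 v, key C.1 C.2 v⟩) ?_, ?_⟩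
      invFun := fun D => ⟨SimpleGraph.Coloring.mk (fun v => (e.symm (D.1 v) : Fin n)) ?_, ?_⟩
      left_inv := ?_
      right_inv := ?_ }
  · intro u v huv h
    have := congrArg Subtype.val (e.injective h)
    exact C.1.valid huv this
  · intro i
    have hi : ((e.symm i : s) : Fin n) ∈ univ.image C.1 := by
      rw [C.2]
      exact (e.symm i).2
    obtain ⟨v, -, hv⟩ := mem_image.1 hi
    refine ⟨v, ?_⟩
    change e ⟨C.1 v, _⟩ = i
    rw [← e.eq_symm_apply]
    exact Subtype.ext hv
  · intro u v huv h
    exact D.1.valid huv (e.symm.injective (Subtype.ext h))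
  · ext i
    simp only [mem_image, mem_univ, true_and]
    constructor
    · rintro ⟨v, rfl⟩
      exact (e.symm (D.1 v)).2
    · intro hi
      obtain ⟨v, hv⟩ := D.2 (e ⟨i, hi⟩)
      refine ⟨v, ?_⟩
      change ((e.symm (D.1 v) : s) : Fin n) = i
      rw [hv]
      simp
  · rintro ⟨C, hC⟩
    apply Subtype.ext
    apply RelHom.ext
    intro v
    exact congrArg Subtype.val (e.symm_apply_apply _)
  · rintro ⟨D, hD⟩
    apply Subtype.ext
    apply RelHom.ext
    intro v
    exact e.apply_symm_apply _

/-- The value of the chromatic polynomial at `n` is the number of proper `n`-colourings. -/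
theorem chromaticPolynomial_eval (G : SimpleGraph V) (n : ℕ) :
    (chromaticPolynomial G).eval (n : ℚ) = Nat.card (G.Coloring (Fin n)) := by
  classical
  have h1 : Nat.card (G.Coloring (Fin n)) =
      ∑ k ∈ range (n + 1), n.choose k * orderedIndepPartitions G k := by
    have h := sum_powerset_apply_card (fun k => orderedIndepPartitions G k)
      (x := (univ : Finset (Fin n)))
    simp only [card_univ, Fintype.card_fin, smul_eq_mul, powerset_univ] at h
    rw [← h, Nat.card_congr (Equiv.sigmaFiberEquiv
      (fun C : G.Coloring (Fin n) => univ.image C)).symm, Nat.card_sigma]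
    exact sum_congr rfl fun s _ => card_coloring_image G s
  have h2 : ∀ N, n ≤ N → Fintype.card V ≤ N →
      ((∑ k ∈ range (n + 1), n.choose k * orderedIndepPartitions G k =
        ∑ k ∈ range (N + 1), n.choose k * orderedIndepPartitions G k) ∧
       ∑ k ∈ range (Fintype.card V + 1), n.choose k * orderedIndepPartitions G k =
        ∑ k ∈ range (N + 1), n.choose k * orderedIndepPartitions G k) := by
    intro N hn hV
    constructor
    · refine sum_subset (range_subset_range.2 (by omega)) fun k _ hk => ?_
      rw [Nat.choose_eq_zero_of_lt (by simpa using hk), zero_mul]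
    · refine sum_subset (range_subset_range.2 (by omega)) fun k _ hk => ?_
      rw [orderedIndepPartitions_eq_zero G (by simpa using hk), mul_zero]
  obtain ⟨h3, h4⟩ := h2 _ (le_max_left _ _) (le_max_right _ _)
  rw [h1, h3, ← h4, chromaticPolynomial, eval_finsetSum, Nat.cast_sum]
  refine sum_congr rfl fun k _ => ?_
  rw [eval_mul, eval_C, descPochhammer_eval_eq_descFactorial,
    Nat.descFactorial_eq_factorial_mul_choose]
  have : (k.factorial : ℚ) ≠ 0 := by exact_mod_cast k.factorial_ne_zero
  push_cast
  field_simp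

end Chromatic

/-! ### The bond lattice -/

section Bond

variable {V : Type*} [Fintype V] [DecidableEq V]

/-- The bond lattice of `G`: the partitions of the vertex set all of whose parts induce connected
subgraphs, ordered by refinement (`π' ≤ π` iff `π'` refines `π`). -/
abbrev BondLattice (G : SimpleGraph V) : Type _ :=
  {π : Finpartition (univ : Finset V) // ∀ S ∈ π.parts, (G.induce (S : Set V)).Connected}

noncomputable instance BondLattice.instFintype (G : SimpleGraph V) : Fintype (BondLattice G) :=
  Fintype.ofFinite _

theorem bot_parts_connected (G : SimpleGraph V) :
    ∀ S ∈ (⊥ : Finpartition (univ : Finset V)).parts, (G.induce (S : Set V)).Connected := by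
  intro S hS
  obtain ⟨v, -, rfl⟩ := Finpartition.mem_bot_iff.1 hS
  simpa using SimpleGraph.Connected.of_subsingleton

/-- The minimal element `0̂`, the partition into singletons. -/
instance BondLattice.instOrderBot (G : SimpleGraph V) : OrderBot (BondLattice G) where
  bot := ⟨⊥, bot_parts_connected G⟩
  bot_le π := (bot_le : (⊥ : Finpartition (univ : Finset V)) ≤ π.1)

variable (G : SimpleGraph V) [DecidableRel G.Adj]

/-- `e(S)`: the number of edges of `G` with both ends in `S`. -/
def inducedEdgeCount (S : Finset V) : ℕ :=
  #{e ∈ G.edgeFinset | ∀ v ∈ e, v ∈ S}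

/-- `e(S', S'')` for a family `{S', S''}` of two disjoint sets: the number of edges of `G` that have
an end in each member of the family. -/
def straddlingEdgeCount (F : Finset (Finset V)) : ℕ :=
  #{e ∈ G.edgeFinset | ∀ T ∈ F, ∃ v ∈ T, v ∈ e}

variable {G}

/-- `d(π)`: the number of non-singleton parts of `π`. -/
def nonSingletonParts (π : BondLattice G) : ℕ :=
  #{S ∈ π.1.parts | 1 < #S}

/-- The weight `w(π, π') = e(S', S'') / (d(π) e(S))` of an edge `π → π'` of the bond lattice, where
`π'` arises from `π` by splitting the part `S` into `S' ⊔ S''`. Here `S` is the only element of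
`π.parts \ π'.parts`, and `S'`, `S''` are the elements of `π'.parts \ π.parts`; see
`bondWeight_eq`. It is used only where `π` covers `π'`. -/
def bondWeight (π π' : BondLattice G) : ℚ :=
  (1 / (nonSingletonParts π : ℚ)) *
    ((straddlingEdgeCount G (π'.1.parts \ π.1.parts) : ℚ) /
      (∑ S ∈ π.1.parts \ π'.1.parts, inducedEdgeCount G S : ℕ))

theorem straddlingEdgeCount_pair {A B : Finset V} (h : Disjoint A B) :
    straddlingEdgeCount G {A, B} = #(G.interedges A B) := by
  symm
  refine card_bij (fun p _ => s(p.1, p.2)) ?_ ?_ ?_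
  · rintro ⟨a, b⟩ hab
    obtain ⟨ha, hb, hadj⟩ := (SimpleGraph.mem_interedges_iff G).1 hab
    simp only [mem_filter, SimpleGraph.mem_edgeFinset, SimpleGraph.mem_edgeSet, mem_insert,
      mem_singleton, forall_eq_or_imp, forall_eq]
    exact ⟨hadj, ⟨a, ha, by simp⟩, ⟨b, hb, by simp⟩⟩
  · rintro ⟨a, b⟩ hab ⟨c, d⟩ hcd heq
    obtain ⟨ha, hb, -⟩ := (SimpleGraph.mem_interedges_iff G).1 hab
    obtain ⟨hc, hd, -⟩ := (SimpleGraph.mem_interedges_iff G).1 hcd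
    rcases Sym2.eq_iff.1 heq with ⟨h1, h2⟩ | ⟨h1, h2⟩
    · exact Prod.ext h1 h2
    · simp only at h1 h2 ha hd
      subst h1
      exact absurd hd (disjoint_left.1 h ha)
  · intro e he
    simp only [mem_filter, SimpleGraph.mem_edgeFinset, mem_insert,
      mem_singleton, forall_eq_or_imp, forall_eq] at he
    obtain ⟨hadj, ⟨a, ha, hae⟩, ⟨b, hb, hbe⟩⟩ := he
    have hne : a ≠ b := fun hab => disjoint_left.1 h ha (hab ▸ hb)
    have : e = s(a, b) := ((Sym2.mem_and_mem_iff hne).1 ⟨hae, hbe⟩)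
    subst this
    exact ⟨(a, b), (SimpleGraph.mem_interedges_iff G).2 ⟨ha, hb, hadj⟩, rfl⟩

/-- If `π'` arises from `π` by replacing the part `A ∪ B` by the two parts `A` and `B`, then
`bondWeight π π' = (1 / d(π)) * (e(A, B) / e(A ∪ B))`. -/
theorem bondWeight_eq (π π' : BondLattice G) {A B : Finset V} (hAB : A ≠ B)
    (hA : A ∈ π'.1.parts) (hB : B ∈ π'.1.parts) (hS : A ∪ B ∈ π.1.parts)
    (h : π.1.parts.erase (A ∪ B) = (π'.1.parts.erase A).erase B) :
    bondWeight π π' = (1 / (nonSingletonParts π : ℚ)) *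
      ((#(G.interedges A B) : ℚ) / (inducedEdgeCount G (A ∪ B) : ℚ)) := by
  have hdis : Disjoint A B := π'.1.disjoint hA hB hAB
  have hAne : A.Nonempty := π'.1.nonempty_of_mem_parts hA
  have hBne : B.Nonempty := π'.1.nonempty_of_mem_parts hB
  have hSA : A ∪ B ≠ A := fun e => by
    obtain ⟨b, hb⟩ := hBne
    exact disjoint_left.1 hdis (e ▸ mem_union_right A hb) hb
  have hSB : A ∪ B ≠ B := fun e => by
    obtain ⟨a, ha⟩ := hAne
    exact disjoint_left.1 hdis ha (e ▸ mem_union_left B ha)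
  have hS' : A ∪ B ∉ π'.1.parts := fun hmem => by
    have := π'.1.disjoint hmem hA hSA
    obtain ⟨a, ha⟩ := hAne
    exact disjoint_left.1 this (mem_union_left B ha) ha
  have hh : ∀ T, (T ≠ A ∪ B ∧ T ∈ π.1.parts) ↔ (T ≠ B ∧ T ≠ A ∧ T ∈ π'.1.parts) := by
    intro T
    have := congrArg (T ∈ ·) h
    simpa using this
  have e1 : π.1.parts \ π'.1.parts = {A ∪ B} := by
    ext T
    simp only [mem_sdiff, mem_singleton]
    constructor
    · rintro ⟨h1, h2⟩
      by_contra h3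
      exact h2 ((hh T).1 ⟨h3, h1⟩).2.2
    · rintro rfl
      exact ⟨hS, hS'⟩
  have e2 : π'.1.parts \ π.1.parts = {A, B} := by
    ext T
    simp only [mem_sdiff, mem_singleton, mem_insert]
    constructor
    · rintro ⟨h1, h2⟩
      by_contra! h3
      exact h2 ((hh T).2 ⟨h3.2, h3.1, h1⟩).2
    · rintro (rfl | rfl)
      · exact ⟨hA, fun h1 => ((hh _).1 ⟨hSA.symm, h1⟩).2.1 rfl⟩
      · exact ⟨hB, fun h1 => ((hh _).1 ⟨hSB.symm, h1⟩).1 rfl⟩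
  rw [bondWeight, e1, e2, sum_singleton, straddlingEdgeCount_pair hdis]

variable (G)

open Classical in
/-- The matrix `W`, with rows and columns indexed by the bond lattice: `-w(π, π')` if `π` covers
`π'`, `q` (the polynomial variable) if `π = π' = 0̂`, and `0` otherwise. -/
noncomputable def bondMatrix : Matrix (BondLattice G) (BondLattice G) ℚ[X] :=
  Matrix.of fun π π' =>
    if π' ⋖ π then -C (bondWeight π π')
    else if π = ⊥ ∧ π' = ⊥ then X
    else 0

/-- `W` is upper triangular when the bond lattice is listed in decreasing order with respect to any
linear extension: the entries at `(π, π')` with `π' ≰ π` vanish. -/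
theorem bondMatrix_eq_zero (π π' : BondLattice G) (h : ¬ π' ≤ π) : bondMatrix G π π' = 0 := by
  have h1 : ¬ π' ⋖ π := fun hc => h hc.le
  have h2 : ¬ (π = ⊥ ∧ π' = ⊥) := fun hb => h (hb.2 ▸ bot_le)
  simp [bondMatrix, h1, h2]

end Bond

/-!
Every edge set `A` of `G` has a component partition, which is a bond. For a bond `π` let `F(π)` be
the sum of `(-1) ^ #A` over the edge sets `A` with component partition `π`
(`signedEdgeSetCount`). Inclusion–exclusion over monochromatic edges gives
`χ_G(q) = ∑_π F(π) q ^ |π|` (`chromaticPolynomial_eq_sum`).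

The weights come from toggling an edge. Let `e` be an edge inside a block of `π`, and consider all
edge sets `A` such that `A ∪ {e}` has component partition `π`. Toggling `e` shows that their signs
add up to zero. Such an `A` has component partition either `π` itself or some `π'` covered by `π`
that separates the ends of `e`, and every `A` of the latter kind occurs. Hence `F(π) = -∑ F(π')`
over the `π'` covered by `π` that separate the ends of `e` (`signedEdgeSetCount_eq_neg_sum`). Now
choose `e` at random, first a non-singleton block of `π` and then an edge inside it, both uniformly:
`w(π, π')` is the probability that `π'` separates the ends of `e` (`bondWeight_eq_sum`), so
averaging gives `F(π) = -∑ w(π, π') F(π')` for `π ≠ 0̂`.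

Since a bond has one block less than those it covers, this says that `u(π) = F(π) q ^ |π|` is an
eigenvector of `W` with eigenvalue `q` (`bondMatrix_mulVec`). On the other hand `W` is nilpotent
apart from the loop at `0̂`, so only the column of `W ^ l` at `0̂` is nonzero. Comparing with
`W ^ l u = q ^ l u` and `u(0̂) = q ^ l`, that column is `u`, and the sum of its entries is `χ_G(q)`.
-/

section

variable {V : Type*} [Fintype V] [DecidableEq V] {G : SimpleGraph V}

/-! ### Refinement of bonds in terms of blocks of vertices -/

namespace BondLattice

theorem mem_part_iff (π : BondLattice G) {u v : V} :
    u ∈ π.1.part v ↔ π.1.part u = π.1.part v :=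
  π.1.mem_part_iff_part_eq_part (mem_univ _) (mem_univ _)

theorem exists_part_eq (π : BondLattice G) {S : Finset V} (hS : S ∈ π.1.parts) :
    ∃ u, π.1.part u = S := by
  obtain ⟨u, hu⟩ := π.1.nonempty_of_mem_parts hS
  exact ⟨u, π.1.part_eq_of_mem hS hu⟩

theorem le_iff_part {π ρ : BondLattice G} :
    π ≤ ρ ↔ ∀ u v, π.1.part u = π.1.part v → ρ.1.part u = ρ.1.part v := by
  constructor
  · intro h u v huv
    obtain ⟨S, hS, hsub⟩ := (show π.1 ≤ ρ.1 from h) (π.1.part_mem.2 (mem_univ u))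
    rw [ρ.1.part_eq_of_mem hS (hsub (π.1.mem_part_self.2 (mem_univ u))),
      ρ.1.part_eq_of_mem hS (hsub (π.mem_part_iff.2 huv.symm))]
  · intro h
    change π.1 ≤ ρ.1
    intro S hS
    obtain ⟨u, rfl⟩ := π.exists_part_eq hS
    refine ⟨ρ.1.part u, ρ.1.part_mem.2 (mem_univ u), fun v hv => ?_⟩
    exact ρ.mem_part_iff.2 (h _ _ (π.mem_part_iff.1 hv))

theorem part_bot_injective {u v : V}
    (h : (⊥ : BondLattice G).1.part u = (⊥ : BondLattice G).1.part v) : u = v := by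
  have hu : ({u} : Finset V) ∈ (⊥ : BondLattice G).1.parts :=
    Finpartition.mem_bot_iff.2 ⟨u, mem_univ u, rfl⟩
  have hv := (mem_part_iff ⊥).2 h.symm
  rw [Finpartition.part_eq_of_mem _ hu (mem_singleton_self u)] at hv
  exact (mem_singleton.1 hv).symm

/-- Both ends of `e` lie in the same block of `π`. -/
def Contains (π : BondLattice G) (e : Sym2 V) : Prop :=
  ∃ S ∈ π.1.parts, ∀ v ∈ e, v ∈ S

theorem contains_mk {π : BondLattice G} {u v : V} :
    π.Contains s(u, v) ↔ π.1.part u = π.1.part v := by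
  simp only [Contains, Sym2.mem_iff, forall_eq_or_imp, forall_eq]
  constructor
  · rintro ⟨S, hS, hu, hv⟩
    rw [π.1.part_eq_of_mem hS hu, π.1.part_eq_of_mem hS hv]
  · intro h
    exact ⟨_, π.1.part_mem.2 (mem_univ v), π.mem_part_iff.2 h, π.mem_part_iff.2 rfl⟩

end BondLattice

/-! ### Component partitions of edge sets -/

/-- The spanning subgraph of `G` whose edges are the edges of `G` that belong to `A`. -/
def spanningSubgraph (G : SimpleGraph V) (A : Finset (Sym2 V)) : SimpleGraph V where
  Adj u v := G.Adj u v ∧ s(u, v) ∈ A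
  symm := ⟨fun _ _ h => ⟨h.1.symm, Sym2.eq_swap ▸ h.2⟩⟩
  loopless := ⟨fun _ h => G.loopless.irrefl _ h.1⟩

open Classical in
/-- The partition of the vertices into the connected components of the spanning subgraph with edge
set `A`, as an element of the bond lattice. -/
noncomputable def componentPartition (G : SimpleGraph V) (A : Finset (Sym2 V)) : BondLattice G :=
  ⟨Finpartition.ofSetoid (spanningSubgraph G A).reachableSetoid, by
    intro S hS
    obtain ⟨u, hu⟩ := Finpartition.nonempty_of_mem_parts _ hS
    have hSu := Finpartition.part_eq_of_mem _ hS hu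
    have hmem : ∀ v, v ∈ S ↔ (spanningSubgraph G A).Reachable u v := by
      intro v
      rw [← hSu, Finpartition.mem_part_ofSetoid_iff_rel]
      rfl
    rw [SimpleGraph.connected_iff_exists_forall_reachable]
    refine ⟨⟨u, hu⟩, fun ⟨v, hv⟩ => ?_⟩
    have key : ∀ v, Relation.ReflTransGen (spanningSubgraph G A).Adj u v →
        ∃ h : v ∈ S, (G.induce (S : Set V)).Reachable ⟨u, hu⟩ ⟨v, h⟩ := by
      intro v h
      induction h with
      | refl => exact ⟨hu, .refl _⟩
      | tail h1 h2 ih =>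
        obtain ⟨hb, hr⟩ := ih
        have hc := (hmem _).2 (((hmem _).1 hb).trans (SimpleGraph.Adj.reachable h2))
        exact ⟨hc, hr.trans (SimpleGraph.Adj.reachable (by simpa using h2.1))⟩
    exact (key v ((SimpleGraph.reachable_iff_reflTransGen _ _).1 ((hmem v).1 hv))).2⟩

theorem part_componentPartition_eq_iff {A : Finset (Sym2 V)} {u v : V} :
    (componentPartition G A).1.part u = (componentPartition G A).1.part v ↔
      (spanningSubgraph G A).Reachable u v := by
  classical
  rw [eq_comm, ← BondLattice.mem_part_iff, componentPartition,
    Finpartition.mem_part_ofSetoid_iff_rel]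
  rfl

theorem componentPartition_le_iff {A : Finset (Sym2 V)} {π : BondLattice G} :
    componentPartition G A ≤ π ↔
      ∀ u v, G.Adj u v → s(u, v) ∈ A → π.1.part u = π.1.part v := by
  rw [BondLattice.le_iff_part]
  constructor
  · intro h u v huv hA
    exact h u v (part_componentPartition_eq_iff.2 (SimpleGraph.Adj.reachable ⟨huv, hA⟩))
  · intro h u v huv
    rw [part_componentPartition_eq_iff, SimpleGraph.reachable_iff_reflTransGen] at huv
    induction huv with
    | refl => rfl
    | tail _ h2 ih => exact ih.trans (h _ _ h2.1 h2.2)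

/-- The blocks of `π` are connected in `G`, so an edge set containing all edges of `G` inside the
blocks of `π` connects each of them. -/
theorem le_componentPartition {A : Finset (Sym2 V)} {π : BondLattice G}
    (h : ∀ u v, G.Adj u v → π.1.part u = π.1.part v → s(u, v) ∈ A) :
    π ≤ componentPartition G A := by
  rw [BondLattice.le_iff_part]
  intro u v huv
  rw [part_componentPartition_eq_iff]
  have hu : u ∈ π.1.part u := π.mem_part_iff.2 rfl
  have hv : v ∈ π.1.part u := π.mem_part_iff.2 huv.symm
  let f : G.induce (π.1.part u : Set V) →g spanningSubgraph G A :=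
    { toFun := Subtype.val
      map_rel' := fun {a b} hab => ⟨hab, h _ _ hab
        ((π.mem_part_iff.1 a.2).trans (π.mem_part_iff.1 b.2).symm)⟩ }
  exact ((π.2 _ (π.1.part_mem.2 (mem_univ u))).preconnected ⟨u, hu⟩ ⟨v, hv⟩).map f

open Classical in
theorem componentPartition_internalEdges (π : BondLattice G) :
    componentPartition G {e | π.Contains e} = π :=
  le_antisymm
    (componentPartition_le_iff.2 fun _ _ _ h => BondLattice.contains_mk.1 (mem_filter.1 h).2)
    (le_componentPartition fun _ _ _ h =>
      mem_filter.2 ⟨mem_univ _, BondLattice.contains_mk.2 h⟩)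

/-- Adding the edge `xy` merges at most the components of `x` and `y`. -/
theorem part_componentPartition_insert {A : Finset (Sym2 V)} {x y u v : V}
    (h : (componentPartition G (insert s(x, y) A)).1.part u =
      (componentPartition G (insert s(x, y) A)).1.part v) :
    (componentPartition G A).1.part u = (componentPartition G A).1.part v ∨
    ((componentPartition G A).1.part u = (componentPartition G A).1.part x ∧
      (componentPartition G A).1.part v = (componentPartition G A).1.part y) ∨
    ((componentPartition G A).1.part u = (componentPartition G A).1.part y ∧
      (componentPartition G A).1.part v = (componentPartition G A).1.part x) := by
  rw [part_componentPartition_eq_iff, SimpleGraph.reachable_iff_reflTransGen] at h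
  induction h with
  | refl => exact .inl rfl
  | tail _ h2 ih =>
    rename_i b c _
    obtain ⟨hadj, hm⟩ := h2
    rcases mem_insert.1 hm with he | hA
    · rcases Sym2.eq_iff.1 he with ⟨rfl, rfl⟩ | ⟨rfl, rfl⟩ <;> grind
    · have := part_componentPartition_eq_iff.2
        (SimpleGraph.Adj.reachable (G := spanningSubgraph G A) ⟨hadj, hA⟩)
      grind

theorem componentPartition_mono {A B : Finset (Sym2 V)} (h : A ⊆ B) :
    componentPartition G A ≤ componentPartition G B :=
  componentPartition_le_iff.2 fun _ _ huv hA => part_componentPartition_eq_iff.2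
    (SimpleGraph.Adj.reachable ⟨huv, h hA⟩)

theorem part_componentPartition_insert_eq {A : Finset (Sym2 V)} {x y : V} (hxy : G.Adj x y) :
    (componentPartition G (insert s(x, y) A)).1.part x =
      (componentPartition G (insert s(x, y) A)).1.part y :=
  part_componentPartition_eq_iff.2 (SimpleGraph.Adj.reachable ⟨hxy, mem_insert_self _ _⟩)

theorem componentPartition_insert_le {A : Finset (Sym2 V)} {x y : V} {π : BondLattice G}
    (h : componentPartition G A ≤ π) (hπ : π.1.part x = π.1.part y) :
    componentPartition G (insert s(x, y) A) ≤ π := by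
  rw [componentPartition_le_iff] at h ⊢
  intro u v huv hm
  rcases mem_insert.1 hm with he | hA
  · rcases Sym2.eq_iff.1 he with ⟨rfl, rfl⟩ | ⟨rfl, rfl⟩
    · exact hπ
    · exact hπ.symm
  · exact h u v huv hA

/-! ### Coverings in the bond lattice -/

theorem componentPartition_covBy_insert {A : Finset (Sym2 V)} {x y : V} (hxy : G.Adj x y)
    (h : (componentPartition G A).1.part x ≠ (componentPartition G A).1.part y) :
    componentPartition G A ⋖ componentPartition G (insert s(x, y) A) := by
  refine ⟨lt_of_le_of_ne (componentPartition_mono (subset_insert _ _)) fun he => ?_, ?_⟩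
  · exact h (he ▸ part_componentPartition_insert_eq hxy)
  · intro ρ h1 h2
    by_cases hρ : ρ.1.part x = ρ.1.part y
    · exact h2.not_ge (componentPartition_insert_le h1.le hρ)
    · -- a partition in the interval that separates `x` and `y` does not merge their components, the
      -- only ones that the edge `xy` merges
      refine h1.not_ge (BondLattice.le_iff_part.2 fun u v huv => ?_)
      have hle := BondLattice.le_iff_part.1 h1.le
      rcases part_componentPartition_insert (BondLattice.le_iff_part.1 h2.le u v huv) with
        h | ⟨ha, hb⟩ | ⟨ha, hb⟩
      · exact h
      · exact absurd ((hle _ _ ha).symm.trans (huv.trans (hle _ _ hb))) hρ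
      · exact absurd ((hle _ _ hb).symm.trans (huv.symm.trans (hle _ _ ha))) hρ

/-- A covering relation in the bond lattice comes from merging the blocks of the two ends of an edge
of `G`. -/
theorem exists_insert_of_covBy {π' π : BondLattice G} (h : π' ⋖ π) :
    ∃ A x y, G.Adj x y ∧ componentPartition G A = π' ∧
      componentPartition G (insert s(x, y) A) = π ∧ π'.1.part x ≠ π'.1.part y := by
  classical
  have hex : ∃ x y, G.Adj x y ∧ π.1.part x = π.1.part y ∧ π'.1.part x ≠ π'.1.part y := by
    by_contra! hcon
    refine h.lt.not_ge ?_
    rw [← componentPartition_internalEdges π, componentPartition_le_iff]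
    intro u v huv hm
    exact hcon u v huv (BondLattice.contains_mk.1 (mem_filter.1 hm).2)
  obtain ⟨x, y, hxy, hπ, hπ'⟩ := hex
  have hA := componentPartition_internalEdges π'
  refine ⟨_, x, y, hxy, hA, ?_, hπ'⟩
  refine (h.eq_or_eq ?_ ?_).resolve_left fun he => ?_
  · exact hA.ge.trans (componentPartition_mono (subset_insert _ _))
  · exact componentPartition_insert_le (hA.le.trans h.le) hπ
  · refine hπ' ?_
    have := part_componentPartition_insert_eq (A := {e | π'.Contains e}) hxy
    rwa [he] at this

/-- If `π` covers `π'`, then `π'` arises from `π` by splitting one block into two. -/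
theorem covBy_split {π' π : BondLattice G} (h : π' ⋖ π) :
    ∃ A B, A ∈ π'.1.parts ∧ B ∈ π'.1.parts ∧ A ≠ B ∧
      π.1.parts \ π'.1.parts = {A ∪ B} ∧ π'.1.parts \ π.1.parts = {A, B} := by
  obtain ⟨E, x, y, hxy, rfl, rfl, hne⟩ := exists_insert_of_covBy h
  set π' := componentPartition G E with hπ'
  set π := componentPartition G (insert s(x, y) E) with hπ
  have hle := BondLattice.le_iff_part.1 h.le
  have hins : ∀ {u v}, π.1.part u = π.1.part v → π'.1.part u = π'.1.part v ∨
      (π'.1.part u = π'.1.part x ∧ π'.1.part v = π'.1.part y) ∨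
      (π'.1.part u = π'.1.part y ∧ π'.1.part v = π'.1.part x) :=
    fun h => part_componentPartition_insert h
  have hxy' : π.1.part x = π.1.part y := part_componentPartition_insert_eq hxy
  have hmem : ∀ u, π.1.part u ∈ π.1.parts := fun u => π.1.part_mem.2 (mem_univ u)
  have hmem' : ∀ u, π'.1.part u ∈ π'.1.parts := fun u => π'.1.part_mem.2 (mem_univ u)
  have hS : π.1.part x = π'.1.part x ∪ π'.1.part y := by
    ext v
    rw [mem_union, π.mem_part_iff, π'.mem_part_iff, π'.mem_part_iff]
    constructor
    · intro h
      rcases hins h with h | h | h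
      · exact .inl h
      · exact .inl h.1
      · exact .inr h.1
    · rintro (h | h)
      · exact hle _ _ h
      · exact (hle _ _ h).trans hxy'.symm
  -- away from the merged block the two partitions agree
  have hsame : ∀ u, π.1.part u ≠ π.1.part x → π.1.part u = π'.1.part u := by
    intro u hu
    ext v
    rw [π.mem_part_iff, π'.mem_part_iff]
    refine ⟨fun h => ?_, hle _ _⟩
    rcases hins h with h | h | h
    · exact h
    · exact absurd ((hle _ _ h.2).trans hxy'.symm) hu
    · exact absurd (hle _ _ h.2) hu
  refine ⟨_, _, hmem' x, hmem' y, hne, ?_, ?_⟩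
  · rw [← hS]
    ext T
    simp only [mem_sdiff, mem_singleton]
    constructor
    · rintro ⟨h1, h2⟩
      obtain ⟨u, rfl⟩ := π.exists_part_eq h1
      by_contra hu
      exact h2 (hsame u hu ▸ hmem' u)
    · rintro rfl
      refine ⟨hmem x, fun h => hne ?_⟩
      rw [π'.1.part_eq_of_mem h (π.mem_part_iff.2 rfl),
        π'.1.part_eq_of_mem h (π.mem_part_iff.2 hxy'.symm)]
  · ext T
    simp only [mem_sdiff, mem_insert, mem_singleton]
    constructor
    · rintro ⟨h1, h2⟩
      obtain ⟨u, rfl⟩ := π'.exists_part_eq h1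
      by_cases hu : π.1.part u = π.1.part x
      · rcases hins hu with h | h | h
        · exact .inl h
        · exact .inl h.1
        · exact .inr h.1
      · exact absurd (hsame u hu ▸ hmem u) h2
    · rintro (rfl | rfl)
      · refine ⟨hmem' x, fun h => hne ?_⟩
        have := π.1.part_eq_of_mem h (π'.mem_part_iff.2 rfl)
        exact (π'.mem_part_iff.1 (this ▸ π.mem_part_iff.2 hxy'.symm)).symm
      · refine ⟨hmem' y, fun h => hne ?_⟩
        have := π.1.part_eq_of_mem h (π'.mem_part_iff.2 rfl)
        exact π'.mem_part_iff.1 (this ▸ π.mem_part_iff.2 hxy')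

theorem card_parts_of_covBy {π' π : BondLattice G} (h : π' ⋖ π) :
    #π'.1.parts = #π.1.parts + 1 := by
  obtain ⟨A, B, -, -, hAB, h1, h2⟩ := covBy_split h
  have e1 := card_sdiff_add_card π.1.parts π'.1.parts
  have e2 := card_sdiff_add_card π'.1.parts π.1.parts
  rw [h1, card_singleton] at e1
  rw [h2, card_pair hAB, union_comm] at e2
  omega

theorem nonSingletonParts_pos {π : BondLattice G} (h : π ≠ ⊥) : 0 < nonSingletonParts π := by
  refine Nat.pos_of_ne_zero fun h0 => h (le_bot_iff.1 (BondLattice.le_iff_part.2 fun u v huv => ?_))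
  rw [nonSingletonParts, card_eq_zero, filter_eq_empty_iff] at h0
  have hc := h0 (π.1.part_mem.2 (mem_univ u))
  rw [not_lt, card_le_one] at hc
  rw [hc u (π.mem_part_iff.2 rfl) v (π.mem_part_iff.2 huv.symm)]

/-! ### Colourings constant along an edge set -/

/-- A colouring constant along the edges of `A` is a colouring of the components. -/
theorem card_monochromatic (A : Finset (Sym2 V)) (hA : ∀ e ∈ A, e ∈ G.edgeSet) (n : ℕ) :
    Nat.card {c : V → Fin n // ∀ e ∈ A, (e.map c).IsDiag} =
      n ^ #(componentPartition G A).1.parts := by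
  set π := componentPartition G A with hπ
  have hrep : ∀ S : π.1.parts, ∃ u, π.1.part u = S := fun S => π.exists_part_eq S.2
  choose r hr using hrep
  have hconst : ∀ c : {c : V → Fin n // ∀ e ∈ A, (e.map c).IsDiag}, ∀ u v,
      π.1.part u = π.1.part v → c.1 u = c.1 v := by
    intro c u v huv
    rw [hπ, part_componentPartition_eq_iff, SimpleGraph.reachable_iff_reflTransGen] at huv
    induction huv with
    | refl => rfl
    | tail _ h2 ih => exact ih.trans (by simpa using c.2 _ h2.2)
  have e : {c : V → Fin n // ∀ e ∈ A, (e.map c).IsDiag} ≃ (π.1.parts → Fin n) :=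
    { toFun := fun c S => c.1 (r S)
      invFun := fun f => ⟨fun v => f ⟨π.1.part v, π.1.part_mem.2 (mem_univ v)⟩, by
        intro e he
        induction e with
        | h u v =>
          have := componentPartition_le_iff.1 le_rfl u v (hA _ he) he
          simp only [Sym2.map_mk, Sym2.mk_isDiag_iff]
          congr 2⟩
      left_inv := fun c => Subtype.ext (funext fun v => hconst c _ _ (hr _))
      right_inv := fun f => funext fun S => congrArg f (Subtype.ext (hr S)) }
  rw [Nat.card_congr e, Nat.card_fun]
  simp

variable [DecidableRel G.Adj]

/-! ### Signed counts of edge sets -/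

open Classical in
/-- The signed number of edge sets whose component partition is `π`, an edge set `A` being counted
with the sign `(-1) ^ #A`. By Whitney's theorem this is the value at `(0̂, π)` of the Möbius function
of the bond lattice. -/
noncomputable def signedEdgeSetCount (π : BondLattice G) : ℚ :=
  ∑ A ∈ G.edgeFinset.powerset with componentPartition G A = π, (-1) ^ #A

theorem signedEdgeSetCount_bot : signedEdgeSetCount (⊥ : BondLattice G) = 1 := by
  classical
  have : ({A ∈ G.edgeFinset.powerset | componentPartition G A = ⊥} : Finset (Finset (Sym2 V))) =
      {∅} := by
    ext A
    simp only [mem_filter, mem_powerset, mem_singleton]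
    constructor
    · rintro ⟨hA, h⟩
      refine eq_empty_of_forall_notMem fun e he => ?_
      induction e with
      | h u v =>
        have huv : G.Adj u v := by simpa using hA he
        exact huv.ne (BondLattice.part_bot_injective
          (componentPartition_le_iff.1 h.le u v huv he))
    · rintro rfl
      exact ⟨empty_subset _, le_bot_iff.1 (componentPartition_le_iff.2 (by simp))⟩
  rw [signedEdgeSetCount, this]
  simp

open Classical in
/-- Toggling an edge `e` inside a block of `π` cancels all edge sets `A` for which `A ∪ {e}` has
component partition `π`. Those of them that do not themselves have component partition `π` are
exactly the edge sets whose component partition is covered by `π` and separates the ends of `e`. -/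
theorem signedEdgeSetCount_eq_neg_sum {π : BondLattice G} {e : Sym2 V} (he : e ∈ G.edgeFinset)
    (hπ : π.Contains e) :
    signedEdgeSetCount π =
      -∑ π' with π' ⋖ π ∧ ¬ π'.Contains e, signedEdgeSetCount π' := by
  induction e with
  | h x y =>
  have hxy : G.Adj x y := by simpa using he
  have hzero : ∑ A ∈ G.edgeFinset.powerset with
      componentPartition G (insert s(x, y) A) = π, (-1 : ℚ) ^ #A = 0 := by
    refine sum_involution (fun A _ => if s(x, y) ∈ A then A.erase s(x, y) else insert s(x, y) A)
      ?_ ?_ ?_ ?_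
    · intro A _
      split_ifs with h
      · rw [← card_erase_add_one h, pow_succ]
        ring
      · rw [card_insert_of_notMem h, pow_succ]
        ring
    · intro A _ _
      split_ifs with h
      · exact fun h' => notMem_erase s(x, y) A (h'.symm ▸ h)
      · exact fun h' => h (h' ▸ mem_insert_self _ _)
    · intro A hA
      simp only [mem_filter, mem_powerset] at hA ⊢
      split_ifs with h
      · exact ⟨(erase_subset _ _).trans hA.1, by rw [insert_erase h, ← hA.2, insert_eq_of_mem h]⟩
      · exact ⟨insert_subset he hA.1, by rw [insert_idem, hA.2]⟩
    · intro A _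
      by_cases h : s(x, y) ∈ A
      · simp [h, insert_erase h]
      · simp [h, erase_insert h]
  have hrest : ∑ π' with π' ⋖ π ∧ ¬ π'.Contains s(x, y), signedEdgeSetCount π' =
      ∑ A ∈ G.edgeFinset.powerset with
        (componentPartition G A ⋖ π ∧ ¬ (componentPartition G A).Contains s(x, y)),
        (-1 : ℚ) ^ #A := by
    simp only [signedEdgeSetCount]
    rw [← sum_fiberwise_of_maps_to (g := componentPartition G)
      (t := {π' | π' ⋖ π ∧ ¬ π'.Contains s(x, y)}) (by intro A hA; simpa using (mem_filter.1 hA).2)]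
    refine sum_congr rfl fun π' hπ' => sum_congr ?_ fun _ _ => rfl
    simp only [mem_filter, mem_univ, true_and] at hπ'
    ext A
    simp only [mem_filter]
    constructor
    · rintro ⟨h1, rfl⟩
      exact ⟨⟨h1, hπ'⟩, rfl⟩
    · rintro ⟨⟨h1, -⟩, h2⟩
      exact ⟨h1, h2⟩
  rw [hrest, eq_neg_iff_add_eq_zero, signedEdgeSetCount, ← hzero, ← sum_union]
  · refine sum_congr ?_ fun _ _ => rfl
    ext A
    simp only [mem_union, mem_filter, mem_powerset, ← and_or_left, BondLattice.contains_mk]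
    rw [BondLattice.contains_mk] at hπ
    refine and_congr_right fun _ => ⟨?_, fun h => ?_⟩
    · rintro (rfl | ⟨hc, hn⟩)
      · exact le_antisymm (componentPartition_insert_le le_rfl hπ)
          (componentPartition_mono (subset_insert _ _))
      · exact (hc.eq_or_eq (componentPartition_mono (subset_insert _ _))
          (componentPartition_insert_le hc.le hπ)).resolve_left
          (componentPartition_covBy_insert hxy hn).lt.ne'
    · by_cases hA : (componentPartition G A).1.part x = (componentPartition G A).1.part y
      · exact .inl (h ▸ le_antisymm (componentPartition_mono (subset_insert _ _))
          (componentPartition_insert_le le_rfl hA))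
      · exact .inr ⟨h ▸ componentPartition_covBy_insert hxy hA, hA⟩
  · rw [disjoint_left]
    intro A h1 h2
    simp only [mem_filter] at h1 h2
    exact h2.2.1.lt.ne h1.2

/-! ### The recursion given by the weights -/

theorem inducedEdgeCount_pos {π : BondLattice G} {S : Finset V} (hS : S ∈ π.1.parts)
    (h : 1 < #S) : 0 < inducedEdgeCount G S := by
  obtain ⟨a, ha, b, hb, hab⟩ := one_lt_card.1 h
  have : Nontrivial (S : Set V) := ⟨⟨a, ha⟩, ⟨b, hb⟩, by simpa using hab⟩
  obtain ⟨c, hc⟩ := (π.2 S hS).preconnected.exists_adj_of_nontrivial ⟨a, ha⟩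
  refine card_pos.2 ⟨s(a, c.1), ?_⟩
  have hac : G.Adj a c.1 := hc
  have hcS : c.1 ∈ S := c.2
  simp [hac, ha, hcS]

open Classical in
/-- The weight of a covering pair is the probability that an edge of `G`, chosen by first choosing a
non-singleton block of `π` uniformly and then an edge inside this block uniformly, is separated
by `π'`. -/
theorem bondWeight_eq_sum {π' π : BondLattice G} (h : π' ⋖ π) :
    bondWeight π π' = ∑ T ∈ π.1.parts with 1 < #T,
      ∑ e ∈ G.edgeFinset with ∀ v ∈ e, v ∈ T,
        if ¬ π'.Contains e then
          (1 / ((nonSingletonParts π : ℚ) * (inducedEdgeCount G T : ℚ))) else 0 := by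
  obtain ⟨A, B, hA, hB, hAB, h1, h2⟩ := covBy_split h
  have hdis : Disjoint A B := π'.1.disjoint hA hB hAB
  have hS : A ∪ B ∈ π.1.parts ∧ A ∪ B ∉ π'.1.parts := by
    rw [← mem_sdiff, h1]
    exact mem_singleton_self _
  have hcard : 1 < #(A ∪ B) := by
    rw [card_union_of_disjoint hdis]
    have := card_pos.2 (π'.1.nonempty_of_mem_parts hA)
    have := card_pos.2 (π'.1.nonempty_of_mem_parts hB)
    omega
  rw [bondWeight, h1, h2, sum_singleton, sum_eq_single (A ∪ B)]
  · rw [← sum_filter, sum_const, nsmul_eq_mul, filter_filter, straddlingEdgeCount]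
    have hset : ({e ∈ G.edgeFinset | (∀ v ∈ e, v ∈ A ∪ B) ∧ ¬ π'.Contains e} : Finset (Sym2 V)) =
        {e ∈ G.edgeFinset | ∀ T ∈ ({A, B} : Finset (Finset V)), ∃ v ∈ T, v ∈ e} := by
      refine filter_congr fun e _ => ?_
      simp only [mem_insert, mem_singleton, forall_eq_or_imp, forall_eq]
      constructor
      · rintro ⟨hin, hn⟩
        constructor
        · by_contra! hcon
          exact hn ⟨B, hB, fun v hv => (mem_union.1 (hin v hv)).resolve_left fun hv' =>
            hcon v hv' hv⟩
        · by_contra! hcon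
          exact hn ⟨A, hA, fun v hv => (mem_union.1 (hin v hv)).resolve_right fun hv' =>
            hcon v hv' hv⟩
      · rintro ⟨⟨a, ha, hae⟩, ⟨b, hb, hbe⟩⟩
        have hne : a ≠ b := fun hab => disjoint_left.1 hdis ha (hab ▸ hb)
        obtain rfl : e = s(a, b) := (Sym2.mem_and_mem_iff hne).1 ⟨hae, hbe⟩
        refine ⟨by simp [ha, hb], fun hc => hAB ?_⟩
        rw [BondLattice.contains_mk] at hc
        rw [← π'.1.part_eq_of_mem hA ha, hc, π'.1.part_eq_of_mem hB hb]
    rw [hset, one_div_mul_eq_div, mul_one_div, div_div, mul_comm (nonSingletonParts π : ℚ)]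
  · intro T hT hne
    -- a block other than `A ∪ B` is also a block of `π'`, and so contains no separated edge
    have hT' : T ∈ π'.1.parts := by
      by_contra hcon
      have : T ∈ π.1.parts \ π'.1.parts := mem_sdiff.2 ⟨(mem_filter.1 hT).1, hcon⟩
      rw [h1, mem_singleton] at this
      exact hne this
    refine sum_eq_zero fun e he => if_neg (not_not.2 ⟨T, hT', (mem_filter.1 he).2⟩)
  · intro hcon
    exact absurd (mem_filter.2 ⟨hS.1, hcard⟩) hcon

open Classical in
theorem signedEdgeSetCount_eq_neg_sum_bondWeight {π : BondLattice G} (hπ : π ≠ ⊥) :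
    signedEdgeSetCount π = -∑ π' with π' ⋖ π, bondWeight π π' * signedEdgeSetCount π' := by
  have hd : (nonSingletonParts π : ℚ) ≠ 0 := by exact_mod_cast (nonSingletonParts_pos hπ).ne'
  have havg : signedEdgeSetCount π = ∑ T ∈ π.1.parts with 1 < #T,
      ∑ _e ∈ G.edgeFinset with ∀ v ∈ _e, v ∈ T,
        (1 / ((nonSingletonParts π : ℚ) * (inducedEdgeCount G T : ℚ))) *
          signedEdgeSetCount π := by
    have : ∀ T ∈ ({T ∈ π.1.parts | 1 < #T} : Finset (Finset V)),
        ∑ _e ∈ G.edgeFinset with ∀ v ∈ _e, v ∈ T,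
          (1 / ((nonSingletonParts π : ℚ) * (inducedEdgeCount G T : ℚ))) *
            signedEdgeSetCount π = signedEdgeSetCount π / nonSingletonParts π := by
      intro T hT
      obtain ⟨hT, hc⟩ := mem_filter.1 hT
      have he : (inducedEdgeCount G T : ℚ) ≠ 0 := by exact_mod_cast (inducedEdgeCount_pos hT hc).ne'
      rw [sum_const, nsmul_eq_mul]
      change (inducedEdgeCount G T : ℚ) * _ = _
      field_simp
    rw [sum_congr rfl this, sum_const, nsmul_eq_mul]
    change _ = (nonSingletonParts π : ℚ) * _
    field_simp
  have hexp : ∀ T ∈ ({T ∈ π.1.parts | 1 < #T} : Finset (Finset V)),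
      ∀ e ∈ ({e ∈ G.edgeFinset | ∀ v ∈ e, v ∈ T} : Finset (Sym2 V)),
        (1 / ((nonSingletonParts π : ℚ) * (inducedEdgeCount G T : ℚ))) * signedEdgeSetCount π =
        -∑ π' with π' ⋖ π, (if ¬ π'.Contains e then
          (1 / ((nonSingletonParts π : ℚ) * (inducedEdgeCount G T : ℚ))) else 0) *
            signedEdgeSetCount π' := by
    intro T hT e he
    obtain ⟨he, heT⟩ := mem_filter.1 he
    rw [signedEdgeSetCount_eq_neg_sum he ⟨T, (mem_filter.1 hT).1, heT⟩, mul_neg, mul_sum,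
      ← filter_filter, sum_filter]
    simp only [ite_mul, zero_mul]
  rw [havg, sum_congr rfl fun T hT => sum_congr rfl (hexp T hT)]
  simp only [sum_neg_distrib]
  congr 1
  simp_rw [sum_comm (s := ({e ∈ G.edgeFinset | _} : Finset (Sym2 V)))]
  rw [sum_comm]
  refine sum_congr rfl fun π' hπ' => ?_
  rw [bondWeight_eq_sum (mem_filter.1 hπ').2, sum_mul]
  exact sum_congr rfl fun T _ => (sum_mul _ _ _).symm

/-! ### Whitney's expansion of the chromatic polynomial -/

/-- Whitney's expansion of the number of proper colourings, by inclusion–exclusion over the set of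
monochromatic edges. -/
theorem card_coloring_eq_sum (n : ℕ) :
    (Nat.card (G.Coloring (Fin n)) : ℚ) =
      ∑ A ∈ G.edgeFinset.powerset, (-1) ^ #A * (n : ℚ) ^ #(componentPartition G A).1.parts := by
  classical
  have h1 : Nat.card (G.Coloring (Fin n)) =
      Nat.card {c : V → Fin n // ∀ e ∈ G.edgeFinset, ¬ (e.map c).IsDiag} := by
    refine Nat.card_congr
      { toFun := fun c => ⟨c, fun e => ?_⟩
        invFun := fun c => SimpleGraph.Coloring.mk c.1 fun {u v} huv => ?_
        left_inv := fun _ => rfl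
        right_inv := fun _ => rfl }
    · induction e with
      | h u v =>
        intro he
        simpa using c.valid (by simpa using he)
    · simpa using c.2 s(u, v) (by simpa using huv)
  have h2 : ∀ c : V → Fin n, (if ∀ e ∈ G.edgeFinset, ¬ (e.map c).IsDiag then (1 : ℚ) else 0) =
      ∑ A ∈ G.edgeFinset.powerset, (-1) ^ #A * if ∀ e ∈ A, (e.map c).IsDiag then (1 : ℚ) else 0 := by
    intro c
    have : (if ∀ e ∈ G.edgeFinset, ¬ (e.map c).IsDiag then (1 : ℚ) else 0) =
        ∏ e ∈ G.edgeFinset, (1 + -(if (e.map c).IsDiag then (1 : ℚ) else 0)) := by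
      split_ifs with h
      · exact (prod_eq_one fun e he => by simp [h e he]).symm
      · push Not at h
        obtain ⟨e, he, hd⟩ := h
        exact (prod_eq_zero he (by simp [hd])).symm
    rw [this, prod_one_add]
    refine sum_congr rfl fun A _ => ?_
    rw [prod_neg, prod_boole]
    congr
  rw [h1, Nat.card_eq_fintype_card, Fintype.card_subtype, ← sum_boole]
  rw [sum_congr rfl fun c _ => h2 c, sum_comm]
  refine sum_congr rfl fun A hA => ?_
  rw [← mul_sum, sum_boole, ← Fintype.card_subtype, ← Nat.card_eq_fintype_card,
    card_monochromatic A (fun e he => by simpa using mem_powerset.1 hA he)]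
  push_cast
  rfl

theorem chromaticPolynomial_eq_sum :
    chromaticPolynomial G =
      ∑ π : BondLattice G, C (signedEdgeSetCount π) * X ^ #π.1.parts := by
  classical
  refine Polynomial.eq_of_infinite_eval_eq _ _
    ((Set.infinite_range_of_injective (Nat.cast_injective (R := ℚ))).mono ?_)
  rintro _ ⟨n, rfl⟩
  change eval _ _ = eval _ _
  rw [chromaticPolynomial_eval, card_coloring_eq_sum, eval_finsetSum,
    ← sum_fiberwise (s := G.edgeFinset.powerset) (componentPartition G)]
  refine sum_congr rfl fun π _ => ?_
  simp only [eval_mul, eval_C, eval_pow, eval_X, signedEdgeSetCount, sum_mul]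
  exact sum_congr rfl fun A hA => by rw [(mem_filter.1 hA).2]

/-! ### Powers of the bond matrix -/

open Matrix in
/-- The terms of `chromaticPolynomial_eq_sum` form an eigenvector of `bondMatrix G`. -/
theorem bondMatrix_mulVec :
    bondMatrix G *ᵥ (fun π => C (signedEdgeSetCount π) * X ^ #π.1.parts) =
      (X : ℚ[X]) • fun π => C (signedEdgeSetCount π) * X ^ #π.1.parts := by
  classical
  funext π
  simp only [mulVec, dotProduct, Pi.smul_apply, smul_eq_mul, bondMatrix, of_apply]
  by_cases hπ : π = ⊥
  · subst hπ
    rw [sum_eq_single ⊥]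
    · simp
    · intro π' _ hne
      have : ¬ π' ⋖ ⊥ := fun h => not_lt_bot h.lt
      simp [this, hne]
    · simp
  · simp only [hπ, false_and, if_false, ite_mul, zero_mul]
    rw [← sum_filter, signedEdgeSetCount_eq_neg_sum_bondWeight hπ, C_neg, map_sum, neg_mul,
      mul_neg, sum_mul, mul_sum, ← sum_neg_distrib]
    refine sum_congr rfl fun π' h => ?_
    rw [card_parts_of_covBy (mem_filter.1 h).2, C_mul, pow_succ]
    ring

theorem bondMatrix_pow_apply_eq_zero {π' : BondLattice G} (h : π' ≠ ⊥) (k : ℕ)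
    (π : BondLattice G) (hk : #π'.1.parts < #π.1.parts + k) : (bondMatrix G ^ k) π π' = 0 := by
  induction k generalizing π' with
  | zero => exact Matrix.one_apply_ne (by rintro rfl; simp at hk)
  | succ k ih =>
    rw [pow_succ, Matrix.mul_apply]
    refine sum_eq_zero fun ρ _ => ?_
    by_cases hc : π' ⋖ ρ
    · rw [ih (bot_le.trans_lt hc.lt).ne' (by have := card_parts_of_covBy hc; omega), zero_mul]
    · simp [bondMatrix, hc, h]

/-- The bond matrix without its loop at `0̂` is nilpotent, so that all walks of length `|V|` end at
`0̂`. -/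
theorem bondMatrix_pow_card_apply_eq_zero {π' : BondLattice G} (h : π' ≠ ⊥) (π : BondLattice G) :
    (bondMatrix G ^ Fintype.card V) π π' = 0 := by
  refine bondMatrix_pow_apply_eq_zero h _ _ ?_
  obtain ⟨v⟩ : Nonempty V := by
    by_contra hV
    rw [not_nonempty_iff] at hV
    exact h (le_bot_iff.1 (BondLattice.le_iff_part.2 fun u => isEmptyElim u))
  have h1 : #π'.1.parts ≤ Fintype.card V := π'.1.card_parts_le_card
  have h2 : 0 < #π.1.parts := card_pos.2 ⟨_, π.1.part_mem.2 (mem_univ v)⟩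
  omega

open Matrix in
theorem bondMatrix_pow_mulVec (k : ℕ) :
    (bondMatrix G ^ k) *ᵥ (fun π => C (signedEdgeSetCount π) * X ^ #π.1.parts) =
      (X : ℚ[X]) ^ k • fun π => C (signedEdgeSetCount π) * X ^ #π.1.parts := by
  induction k with
  | zero => simp
  | succ k ih =>
    rw [pow_succ, ← mulVec_mulVec, bondMatrix_mulVec, mulVec_smul, ih, smul_smul, pow_succ']

theorem bondMatrix_pow_card_apply_bot (π : BondLattice G) :
    (bondMatrix G ^ Fintype.card V) π ⊥ = C (signedEdgeSetCount π) * X ^ #π.1.parts := by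
  have h := congrFun (bondMatrix_pow_mulVec (G := G) (Fintype.card V)) π
  have hbot : #(⊥ : BondLattice G).1.parts = Fintype.card V := Finpartition.card_bot univ
  rw [Matrix.mulVec, dotProduct, sum_eq_single ⊥ (fun π' _ h => by
    rw [bondMatrix_pow_card_apply_eq_zero h, zero_mul]) (by simp), signedEdgeSetCount_bot, hbot,
    C_1, one_mul, Pi.smul_apply, smul_eq_mul, mul_comm] at h
  exact mul_left_cancel₀ (pow_ne_zero _ X_ne_zero) h

end

theorem corollary3 {V : Type*} [Fintype V] [DecidableEq V]
    (G : SimpleGraph V) [DecidableRel G.Adj] :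
    chromaticPolynomial G =
      (fun _ : BondLattice G => (1 : ℚ[X])) ⬝ᵥ
        ((bondMatrix G ^ Fintype.card V).mulVec (fun _ : BondLattice G => (1 : ℚ[X]))) := by
  rw [chromaticPolynomial_eq_sum, dotProduct]
  refine sum_congr rfl fun π _ => ?_
  rw [one_mul, Matrix.mulVec, dotProduct, sum_eq_single ⊥ (fun π' _ h => by
    rw [bondMatrix_pow_card_apply_eq_zero h, zero_mul]) (by simp), mul_one,
    bondMatrix_pow_card_apply_bot]
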